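/- Let $\mathbf{k}$ be a field, $q \in \mathbf{k}$ and $n \ge 0$ an integer. Let $\mathcal{H}_n = \mathcal{H}_n(q)$ be the type-$A$ Iwahori--Hecke algebra, that is, the unital associative $\mathbf{k}$-algebra with generators $T_1, \ldots, T_{n-1}$ and relations $T_i^2 = (q-1)T_i + q$ for all $i$, $T_iT_j = T_jT_i$ for $|i-j|>1$, and $T_iT_{i+1}T_i = T_{i+1}T_iT_{i+1}$ for $1 \le i \le n-2$. Let $a \mapsto a^*$ be the $\mathbf{k}$-linear anti-automorphism of $\mathcal{H}_n$ that fixes every $T_i$. For $0 \le m \le n$ put $\mathcal{B}_m = \sum_{i=1}^m T_{m-1}T_{m-2}\cdots T_i \in \mathcal{H}_n$, and put $\mathcal{B}_m = 0$ for $m<0$. For $k \ge 0$ put $$\mathcal{B}_{n,k} = \mathcal{B}_{n-(k-1)} \cdots \mathcal{B}_{n-1}\mathcal{B}_n, \qquad \mathcal{B}^*_{n,k} = (\mathcal{B}_{n,k})^*, \qquad \mathcal{R}_{n,k} = \frac{1}{[k]!_q}\, \mathcal{B}^*_{n,k}\mathcal{B}_{n,k},$$ where $[j]_q = 1 + q +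 \cdots + q^{j-1}$ and $[k]!_q = [1]_q[2]_q\cdots[k]_q$. Here the quotient $\mathcal{R}_{n,k}$ is formed for an indeterminate parameter, in the Hecke algebra over $\mathbb{Z}[X]$ with parameter $X$ (defined by the same generators and relations), and then the value $q$ is substituted for $X$; so $\mathcal{R}_{n,k}$ makes sense also when $[k]!_q = 0$. Then $\mathcal{R}_{n,k}$ is well defined for every $k \ge 0$: in the Hecke algebra over $\mathbb{Z}[X]$ with parameter $X$ there is exactly one element $r$ with $[k]!_X\, r = \mathcal{B}^*_{n,k}\mathcal{B}_{n,k}$, and if $[k]!_q \ne 0$ in $\mathbf{k}$, then the element of $\mathcal{H}_n(q)$ obtained from $r$ by substituting $q$ for $X$ equals $\frac{1}{[k]!_q}\mathcal{B}^*_{n,k}\mathcal{B}_{n,k}$ computed in $\mathcal{H}_n(q)$. Moreover, the elements $\mathcal{R}_{n,k}$ for all $k \ge 0$ commute: $\mathcal{R}_{n,i}\mathcal{R}_{n,j} = \mathcal{R}_{n,j}\mathcal{R}_{n,i}$ for all $i,j \ge 0$. -/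

import Mathlib

/-- Indices of the generators `T_1, …, T_{n-1}` of the Hecke algebra of the symmetric group on
`{1, …, n}`. -/
abbrev HeckeIndex (n : ℕ) : Type := {i : ℕ // 1 ≤ i ∧ i < n}

/-- The defining relations of the type-A Iwahori–Hecke algebra with parameter `q`. -/
inductive HeckeRel {A : Type*} [CommRing A] (n : ℕ) (q : A) :
    FreeAlgebra A (HeckeIndex n) → FreeAlgebra A (HeckeIndex n) → Prop
  | quadratic (i : HeckeIndex n) :
      HeckeRel n q (FreeAlgebra.ι A i * FreeAlgebra.ι A i)
        ((q - 1) • FreeAlgebra.ι A i + algebraMap A _ q)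
  | far (i j : HeckeIndex n) (h : i.1 + 1 < j.1 ∨ j.1 + 1 < i.1) :
      HeckeRel n q (FreeAlgebra.ι A i * FreeAlgebra.ι A j)
        (FreeAlgebra.ι A j * FreeAlgebra.ι A i)
  | braid (i j : HeckeIndex n) (h : j.1 = i.1 + 1) :
      HeckeRel n q (FreeAlgebra.ι A i * FreeAlgebra.ι A j * FreeAlgebra.ι A i)
        (FreeAlgebra.ι A j * FreeAlgebra.ι A i * FreeAlgebra.ι A j)

/-- The type-A Iwahori–Hecke algebra `H_n(q)` over a commutative ring `A`: the unital associative
`A`-algebra with generators `T_1, …, T_{n-1}` and the relations `HeckeRel`. -/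
def HeckeAlgebra {A : Type*} [CommRing A] (n : ℕ) (q : A) : Type _ :=
  RingQuot (HeckeRel n q)

namespace HeckeAlgebra

noncomputable section

variable {A : Type*} [CommRing A]

instance instRing (n : ℕ) (q : A) : Ring (HeckeAlgebra n q) :=
  inferInstanceAs (Ring (RingQuot (HeckeRel n q)))

instance instAlgebra (n : ℕ) (q : A) : Algebra A (HeckeAlgebra n q) :=
  inferInstanceAs (Algebra A (RingQuot (HeckeRel n q)))

/-- The quotient map from the free algebra. -/
def mk (n : ℕ) (q : A) : FreeAlgebra A (HeckeIndex n) →ₐ[A] HeckeAlgebra n q :=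
  RingQuot.mkAlgHom A (HeckeRel n q)

theorem mk_rel {n : ℕ} {q : A} {x y : FreeAlgebra A (HeckeIndex n)} (h : HeckeRel n q x y) :
    mk n q x = mk n q y :=
  RingQuot.mkAlgHom_rel A h

/-- The generator of `H_n(q)` with a given index. -/
def gen {n : ℕ} (q : A) (i : HeckeIndex n) : HeckeAlgebra n q :=
  mk n q (FreeAlgebra.ι A i)

/-- The generator `T_i` of `H_n(q)`, for `1 ≤ i ≤ n - 1` (and `0` for all other `i`, which are
never used below). -/
def T (n : ℕ) (q : A) (i : ℕ) : HeckeAlgebra n q :=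
  if h : 1 ≤ i ∧ i < n then gen q ⟨i, h⟩ else 0

theorem gen_quadratic {n : ℕ} (q : A) (i : HeckeIndex n) :
    gen q i * gen q i = (q - 1) • gen q i + algebraMap A _ q := by
  simpa [gen] using mk_rel (HeckeRel.quadratic (q := q) i)

theorem gen_far {n : ℕ} (q : A) (i j : HeckeIndex n) (h : i.1 + 1 < j.1 ∨ j.1 + 1 < i.1) :
    gen q i * gen q j = gen q j * gen q i := by
  simpa [gen] using mk_rel (HeckeRel.far (q := q) i j h)

theorem gen_braid {n : ℕ} (q : A) (i j : HeckeIndex n) (h : j.1 = i.1 + 1) :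
    gen q i * gen q j * gen q i = gen q j * gen q i * gen q j := by
  simpa [gen] using mk_rel (HeckeRel.braid (q := q) i j h)

theorem rel_star {n : ℕ} {q : A} (x y : FreeAlgebra A (HeckeIndex n)) (h : HeckeRel n q x y) :
    HeckeRel n q (star x) (star y) := by
  cases h with
  | quadratic i =>
    have e : star ((q - 1) • FreeAlgebra.ι A i + algebraMap A _ q) =
        (q - 1) • FreeAlgebra.ι A i + algebraMap A _ q := by
      rw [star_add, Algebra.smul_def, star_mul, FreeAlgebra.star_algebraMap,
        FreeAlgebra.star_algebraMap, FreeAlgebra.star_ι, Algebra.commutes]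
    rw [e, star_mul, FreeAlgebra.star_ι]
    exact HeckeRel.quadratic i
  | far i j h =>
    simp only [star_mul, FreeAlgebra.star_ι]
    exact HeckeRel.far j i h.symm
  | braid i j h =>
    simp only [star_mul, FreeAlgebra.star_ι, ← mul_assoc]
    exact HeckeRel.braid i j h

/-- The anti-involution `a ↦ a^*`: the `A`-linear anti-automorphism of `H_n(q)` which fixes all
generators `T_i` (see `star_gen` and `star_algebraMap`). -/
instance instStarRing (n : ℕ) (q : A) : StarRing (HeckeAlgebra n q) :=
  RingQuot.starRing (HeckeRel n q) rel_star

theorem star_mk {n : ℕ} {q : A} (x : FreeAlgebra A (HeckeIndex n)) :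
    star (mk n q x) = mk n q (star x) := by
  simp only [mk, RingQuot.mkAlgHom, RingQuot.mkRingHom]
  rfl

theorem star_gen {n : ℕ} (q : A) (i : HeckeIndex n) : star (gen q i) = gen q i := by
  rw [gen, star_mk, FreeAlgebra.star_ι]

theorem star_algebraMap {n : ℕ} (q a : A) :
    star (algebraMap A (HeckeAlgebra n q) a) = algebraMap A _ a := by
  rw [← (mk n q).commutes, star_mk, FreeAlgebra.star_algebraMap]

theorem star_T (n : ℕ) (q : A) (i : ℕ) : star (T n q i) = T n q i := by
  unfold T
  split_ifs
  · exact star_gen q _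
  · exact star_zero _

/-- The `q`-integer `[k]_q = 1 + q + ⋯ + q^(k-1)`. -/
def qInt (q : A) (k : ℕ) : A := ∑ i ∈ Finset.range k, q ^ i

/-- The `q`-factorial `[k]!_q = [1]_q [2]_q ⋯ [k]_q`. -/
def qFactorial (q : A) (k : ℕ) : A := ∏ i ∈ Finset.Icc 1 k, qInt q i

/-- The element `B_m = ∑_{i=1}^m T_{m-1} T_{m-2} ⋯ T_i` of `H_m(q)`, regarded as an element of
`H_n(q)`, where `m ≤ n`. -/
def B (n : ℕ) (q : A) (m : ℕ) : HeckeAlgebra n q :=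
  ∑ i ∈ Finset.Icc 1 m, ((List.Ico i m).reverse.map (T n q)).prod

/-- The `k`-bottom-to-random shuffle `B_{n,k} = B_{n-(k-1)} ⋯ B_{n-1} B_n` in `H_n(q)`. For
`k > n` one of the factors is `B_0 = 0`. -/
def bottomToRandom (n : ℕ) (q : A) (k : ℕ) : HeckeAlgebra n q :=
  ((List.range k).reverse.map fun j => B n q (n - j)).prod

/-- The `k`-random-to-bottom shuffle `B^*_{n,k} = (B_{n,k})^*`. -/
def randomToBottom (n : ℕ) (q : A) (k : ℕ) : HeckeAlgebra n q :=
  star (bottomToRandom n q k)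

theorem star_list_prod {n : ℕ} {q : A} (l : List (HeckeAlgebra n q)) :
    star l.prod = (l.reverse.map star).prod := by
  induction l with
  | nil => simp
  | cons a l ih => simp [star_mul, ih]

/-- Explicit form `B_m^* = ∑_{i=1}^m T_i T_{i+1} ⋯ T_{m-1}`. -/
theorem star_B (n : ℕ) (q : A) (m : ℕ) :
    star (B n q m) = ∑ i ∈ Finset.Icc 1 m, ((List.Ico i m).map (T n q)).prod := by
  simp only [B, star_sum, star_list_prod, ← List.map_reverse, List.reverse_reverse, List.map_map]
  refine Finset.sum_congr rfl fun i _ => ?_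
  congr 2
  funext j
  exact star_T n q j

/-- Explicit form `B_{n,k}^* = B_n^* B_{n-1}^* ⋯ B_{n-(k-1)}^*`. -/
theorem randomToBottom_eq (n : ℕ) (q : A) (k : ℕ) :
    randomToBottom n q k = ((List.range k).map fun j => star (B n q (n - j))).prod := by
  simp only [randomToBottom, bottomToRandom, star_list_prod, ← List.map_reverse,
    List.reverse_reverse, List.map_map]
  rfl

/-- Substitution of `q` for the indeterminate: the ring homomorphism from the Hecke algebra over
`ℤ[X]` with parameter `X` to `H_n(q)` which sends `T_i` to `T_i` and is the evaluation `X ↦ q` on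
scalars (see `specialize_gen` and `specialize_algebraMap`). -/
def specialize (n : ℕ) (q : A) :
    HeckeAlgebra n (Polynomial.X : Polynomial ℤ) →+* HeckeAlgebra n q :=
  letI : Algebra (Polynomial ℤ) (HeckeAlgebra n q) :=
    ((algebraMap A (HeckeAlgebra n q)).comp
      (Polynomial.aeval q : Polynomial ℤ →ₐ[ℤ] A).toRingHom).toAlgebra'
      fun c x => Algebra.commutes (Polynomial.aeval q c) x
  have hmap : ∀ p : Polynomial ℤ, algebraMap (Polynomial ℤ) (HeckeAlgebra n q) p =
      algebraMap A (HeckeAlgebra n q) (Polynomial.aeval q p) := fun _ => rfl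
  (RingQuot.liftAlgHom (Polynomial ℤ)
    (⟨FreeAlgebra.lift (Polynomial ℤ) (gen q), by
      intro x y h
      cases h with
      | quadratic i =>
        rw [Algebra.smul_def]
        simp only [map_mul, map_add, AlgHom.commutes, FreeAlgebra.lift_ι_apply, hmap,
          gen_quadratic, Algebra.smul_def, map_sub, map_one, Polynomial.aeval_X]
      | far i j h => simpa using gen_far q i j h
      | braid i j h => simpa using gen_braid q i j h⟩ :
      {f : FreeAlgebra (Polynomial ℤ) (HeckeIndex n) →ₐ[Polynomial ℤ] HeckeAlgebra n q //
        ∀ ⦃x y⦄, HeckeRel n (Polynomial.X : Polynomial ℤ) x y → f x = f y})).toRingHom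

theorem specialize_gen {n : ℕ} (q : A) (i : HeckeIndex n) :
    specialize n q (gen Polynomial.X i) = gen q i := by
  simp only [specialize, gen, mk]
  let : Algebra (Polynomial ℤ) (HeckeAlgebra n q) :=
    ((algebraMap A (HeckeAlgebra n q)).comp
      (Polynomial.aeval q : Polynomial ℤ →ₐ[ℤ] A).toRingHom).toAlgebra'
      fun c x => Algebra.commutes (Polynomial.aeval q c) x
  refine (RingQuot.liftAlgHom_mkAlgHom_apply (Polynomial ℤ) _ _ _).trans ?_
  exact FreeAlgebra.lift_ι_apply _ _

theorem specialize_algebraMap (n : ℕ) (q : A) (p : Polynomial ℤ) :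
    specialize n q (algebraMap _ _ p) = algebraMap A _ (Polynomial.aeval q p) := by
  let : Algebra (Polynomial ℤ) (HeckeAlgebra n q) :=
    ((algebraMap A (HeckeAlgebra n q)).comp
      (Polynomial.aeval q : Polynomial ℤ →ₐ[ℤ] A).toRingHom).toAlgebra'
      fun c x => Algebra.commutes (Polynomial.aeval q c) x
  exact AlgHom.commutes (RingQuot.liftAlgHom (Polynomial ℤ) _) p

/-- `r` is a quotient `(1 / [k]!_X) B^*_{n,k} B_{n,k}` in the Hecke algebra over `ℤ[X]` whose
parameter is the indeterminate `X`. -/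
def IsGenericRandomToRandom (n k : ℕ)
    (r : HeckeAlgebra n (Polynomial.X : Polynomial ℤ)) : Prop :=
  qFactorial (Polynomial.X : Polynomial ℤ) k • r =
    randomToBottom n Polynomial.X k * bottomToRandom n Polynomial.X k

/-- The quotient `(1 / [k]!_X) B^*_{n,k} B_{n,k}` for an indeterminate parameter `X`. That there is
exactly one such quotient is part of the theorem. -/
def genericRandomToRandom (n k : ℕ) : HeckeAlgebra n (Polynomial.X : Polynomial ℤ) :=
  Classical.epsilon (IsGenericRandomToRandom n k)

/-- The `k`-random-to-random shuffle `R_{n,k} = (1 / [k]!_q) B^*_{n,k} B_{n,k}` in `H_n(q)`: the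
quotient is formed for an indeterminate parameter, and then `q` is substituted, so that it makes
sense also where `[k]!_q` vanishes. -/
def randomToRandom (n : ℕ) (q : A) (k : ℕ) : HeckeAlgebra n q :=
  specialize n q (genericRandomToRandom n k)

end

end HeckeAlgebra

/-! Let P(m,k) be the unnormalized shuffle `shuffle n q m k`, so that P(m+1,k+1) = B*_{m+1} P(m,k)
B_{m+1}, and let J_m be the rescaled Jucys–Murphy element.

Commutativity rests on an exchange rule (`B_mul_shuffle`): up to a power of q, B_{m+1} P(m+1,k+1) =
W B_{m+1}, where W is built from P(m,k+1), P(m,k), J_{m+1} and scalars. It comes from B_{m+1}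
B*_{m+1} = B*_m T_m B_m + [m+1]_q + q J_{m+1} (`B_mul_star_B`) and from T_m B_m B_{m+1} = q B_m
B_{m+1} (`T_mul_B_mul_B`). Since J_{m+1} commutes with T_1, …, T_{m-1}, W is self-adjoint and, by
induction on m, commutes with every P(m,j). Pushing W through B*_{m+1} P(m,j) B_{m+1} gives
commutativity of the P(m+1,·), once powers of q can be cancelled (`shuffle_commute`).

Divisibility by [k]! holds over any ring: B_{n,k} = Σ U, where Σ is the sum over a parabolic S_k,
and Σ* Σ = [k]! Σ (`bottomProd_eq`, `star_parabolicSum_mul`).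

Uniqueness of the quotient and all cancellations need the Hecke algebra over ℤ[X] to be torsion-free
(`eq_zero_of_smul_eq_zero`). This is shown by letting normal forms act on permutations. The
statements over a field follow by specialization. -/

namespace HeckeAlgebra

noncomputable section

variable {A : Type*} [CommRing A]

open Equiv

/-! ### The representation on permutations. -/

/-- The `i`-th generator acting on the free module on permutations of `ℕ` by position swaps. -/
def wordOp (q : A) (i : ℕ) : (Perm ℕ →₀ A) →ₗ[A] (Perm ℕ →₀ A) :=
  Finsupp.linearCombination A fun w =>
    if w i < w (i + 1) then Finsupp.single (w * swap i (i + 1)) 1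
    else (q - 1) • Finsupp.single w 1 + q • Finsupp.single (w * swap i (i + 1)) 1

theorem wordOp_single_of_lt (q : A) {i : ℕ} {w : Perm ℕ} (h : w i < w (i + 1)) :
    wordOp q i (Finsupp.single w 1) = Finsupp.single (w * swap i (i + 1)) 1 := by
  simp [wordOp, h]

theorem wordOp_single_of_gt (q : A) {i : ℕ} {w : Perm ℕ} (h : w (i + 1) < w i) :
    wordOp q i (Finsupp.single w 1) =
      (q - 1) • Finsupp.single w 1 + q • Finsupp.single (w * swap i (i + 1)) 1 := by
  simp [wordOp, h.not_gt]

theorem wordOp_ext {f g : (Perm ℕ →₀ A) →ₗ[A] (Perm ℕ →₀ A)}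
    (h : ∀ w, f (Finsupp.single w 1) = g (Finsupp.single w 1)) : f = g := by
  ext1 w
  ext1
  exact h w

theorem apply_lt_or_gt (w : Perm ℕ) {i j : ℕ} (h : i ≠ j) : w i < w j ∨ w j < w i :=
  lt_or_gt_of_ne (w.injective.ne h)

theorem wordOp_quadratic (q : A) (i : ℕ) :
    wordOp q i * wordOp q i = (q - 1) • wordOp q i + algebraMap A _ q := by
  refine wordOp_ext fun w => ?_
  have hs : (w * swap i (i + 1)) * swap i (i + 1) = w := by simp [mul_assoc]
  rcases apply_lt_or_gt w (Nat.lt_succ_self i).ne with h | h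
  · have h' : (w * swap i (i + 1)) (i + 1) < (w * swap i (i + 1)) i := by simpa using h
    simp [wordOp_single_of_lt q h, wordOp_single_of_gt q h', Module.algebraMap_end_apply]
  · have h' : (w * swap i (i + 1)) i < (w * swap i (i + 1)) (i + 1) := by simpa using h
    simp only [Module.End.mul_apply, wordOp_single_of_gt q h, map_add, map_smul,
      wordOp_single_of_lt q h', hs, LinearMap.add_apply, LinearMap.smul_apply,
      Module.algebraMap_end_apply]

theorem wordOp_far (q : A) {i j : ℕ} (h : i + 1 < j) :
    wordOp q i * wordOp q j = wordOp q j * wordOp q i := by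
  refine wordOp_ext fun w => ?_
  have hc : swap j (j + 1) * swap i (i + 1) = swap i (i + 1) * swap j (j + 1) :=
    (Perm.disjoint_swap_swap (by simp; omega)).commute.eq
  have hs : (w * swap j (j + 1)) * swap i (i + 1) = (w * swap i (i + 1)) * swap j (j + 1) := by
    rw [mul_assoc, hc, mul_assoc]
  have e1 : swap j (j + 1) i = i := swap_apply_of_ne_of_ne (by omega) (by omega)
  have e2 : swap j (j + 1) (i + 1) = i + 1 := swap_apply_of_ne_of_ne (by omega) (by omega)
  have e3 : swap i (i + 1) j = j := swap_apply_of_ne_of_ne (by omega) (by omega)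
  have e4 : swap i (i + 1) (j + 1) = j + 1 := swap_apply_of_ne_of_ne (by omega) (by omega)
  rcases apply_lt_or_gt w (Nat.lt_succ_self i).ne with h1 | h1 <;>
  rcases apply_lt_or_gt w (Nat.lt_succ_self j).ne with h2 | h2 <;>
  · simp only [wordOp, Module.End.mul_apply, Finsupp.linearCombination_single, one_smul, h1, h2,
      h1.not_gt, h2.not_gt, if_true, if_false, map_add, map_smul, Perm.mul_apply, e1, e2, e3, e4,
      hs]
    try module

theorem wordOp_braid (q : A) (i : ℕ) :
    wordOp q i * wordOp q (i + 1) * wordOp q i =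
      wordOp q (i + 1) * wordOp q i * wordOp q (i + 1) := by
  refine wordOp_ext fun w => ?_
  have e1 : swap i (i + 1) i = i + 1 := swap_apply_left _ _
  have e2 : swap i (i + 1) (i + 1) = i := swap_apply_right _ _
  have e3 : swap i (i + 1) (i + 1 + 1) = i + 1 + 1 :=
    swap_apply_of_ne_of_ne (by omega) (by omega)
  have e4 : swap (i + 1) (i + 1 + 1) i = i := swap_apply_of_ne_of_ne (by omega) (by omega)
  have e5 : swap (i + 1) (i + 1 + 1) (i + 1) = i + 1 + 1 := swap_apply_left _ _
  have e6 : swap (i + 1) (i + 1 + 1) (i + 1 + 1) = i + 1 := swap_apply_right _ _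
  have s1 : ∀ v : Perm ℕ, v * swap i (i + 1) * swap i (i + 1) = v := fun v => by
    simp [mul_assoc]
  have s2 : ∀ v : Perm ℕ, v * swap (i + 1) (i + 1 + 1) * swap (i + 1) (i + 1 + 1) = v :=
    fun v => by simp [mul_assoc]
  have hb : ∀ v : Perm ℕ, v * swap (i + 1) (i + 1 + 1) * swap i (i + 1) *
      swap (i + 1) (i + 1 + 1) =
      v * swap i (i + 1) * swap (i + 1) (i + 1 + 1) * swap i (i + 1) := by
    intro v
    have h1 : swap (i + 1) (i + 1 + 1) * swap i (i + 1) * swap (i + 1) (i + 1 + 1) =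
        swap (i + 1 + 1) i := swap_mul_swap_mul_swap (by omega) (by omega)
    have h2 : swap i (i + 1) * swap (i + 1) (i + 1 + 1) * swap i (i + 1) =
        swap (i + 1 + 1) i := by
      rw [swap_comm i (i + 1), swap_comm (i + 1) (i + 1 + 1),
        swap_mul_swap_mul_swap (by omega) (by omega), swap_comm]
    rw [mul_assoc, mul_assoc, ← mul_assoc (swap (i + 1) (i + 1 + 1)), h1, mul_assoc, mul_assoc,
      ← mul_assoc (swap i (i + 1)), h2]
  have n1 : w i ≠ w (i + 1) := w.injective.ne (by omega)
  have n2 : w (i + 1) ≠ w (i + 1 + 1) := w.injective.ne (by omega)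
  have n3 : w i ≠ w (i + 1 + 1) := w.injective.ne (by omega)
  -- The action depends only on the relative order of three letters: of the eight sign patterns two
  -- are contradictory, and the other six are direct computations.
  rcases n1.lt_or_gt with h1 | h1 <;> rcases n2.lt_or_gt with h2 | h2 <;>
    rcases n3.lt_or_gt with h3 | h3 <;> first
  | (exfalso; omega)
  | (simp only [wordOp, Module.End.mul_apply, Finsupp.linearCombination_single, one_smul, h1, h2,
      h3, h1.not_gt, h2.not_gt, h3.not_gt, if_true, if_false, map_add, map_smul, Perm.mul_apply,
      e1, e2, e3, e4, e5, e6, s1, s2, hb]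
     try module)

/-- The representation of the Hecke algebra on the free module on permutations of `ℕ`. -/
def wordRep (n : ℕ) (q : A) : HeckeAlgebra n q →ₐ[A] Module.End A (Perm ℕ →₀ A) :=
  RingQuot.liftAlgHom A
    ⟨FreeAlgebra.lift A fun i : HeckeIndex n => wordOp q i.1, by
      intro x y h
      cases h with
      | quadratic i => simpa using wordOp_quadratic q i.1
      | far i j h =>
        rcases h with h | h
        · simpa using wordOp_far q h
        · simpa using (wordOp_far q h).symm
      | braid i j h => simpa [h] using wordOp_braid q i.1⟩

theorem wordRep_T {n : ℕ} (q : A) {i : ℕ} (h1 : 1 ≤ i) (h2 : i < n) :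
    wordRep n q (T n q i) = wordOp q i := by
  rw [T, dif_pos ⟨h1, h2⟩]
  refine (RingQuot.liftAlgHom_mkAlgHom_apply A _ _ _).trans ?_
  exact FreeAlgebra.lift_ι_apply _ _

/-! ### Relations among the generators and spanning by normal forms. -/

theorem T_of_not {n : ℕ} (q : A) {i : ℕ} (h : ¬(1 ≤ i ∧ i < n)) : T n q i = 0 := dif_neg h

theorem T_sq {n : ℕ} (q : A) {i : ℕ} (h1 : 1 ≤ i) (h2 : i < n) :
    T n q i * T n q i = (q - 1) • T n q i + q • 1 := by
  rw [T, dif_pos ⟨h1, h2⟩, gen_quadratic, Algebra.algebraMap_eq_smul_one]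

theorem T_commute (n : ℕ) (q : A) {i j : ℕ} (h : i + 1 < j) :
    Commute (T n q i) (T n q j) := by
  by_cases hi : 1 ≤ i ∧ i < n
  · by_cases hj : 1 ≤ j ∧ j < n
    · rw [T, T, dif_pos hi, dif_pos hj]
      exact gen_far q _ _ (Or.inl h)
    · rw [T_of_not q hj]; exact Commute.zero_right _
  · rw [T_of_not q hi]; exact Commute.zero_left _

theorem T_braid (n : ℕ) (q : A) (i : ℕ) :
    T n q i * T n q (i + 1) * T n q i = T n q (i + 1) * T n q i * T n q (i + 1) := by
  by_cases hi : 1 ≤ i ∧ i < n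
  · by_cases hj : 1 ≤ i + 1 ∧ i + 1 < n
    · rw [T, T, dif_pos hi, dif_pos hj]
      exact gen_braid q _ _ rfl
    · rw [T_of_not q hj]; simp
  · rw [T_of_not q hi]; simp

/-- The ascending product `T_a T_{a+1} ⋯ T_{a+j-1}`. -/
def ascProd (n : ℕ) (q : A) : ℕ → ℕ → HeckeAlgebra n q
  | _, 0 => 1
  | a, j + 1 => T n q a * ascProd n q (a + 1) j

theorem ascProd_succ' (n : ℕ) (q : A) (a j : ℕ) :
    ascProd n q a (j + 1) = ascProd n q a j * T n q (a + j) := by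
  induction j generalizing a with
  | zero => simp [ascProd]
  | succ j ih =>
    rw [ascProd, ih, ascProd, mul_assoc]
    congr 3
    omega

theorem T_commute_ascProd (n : ℕ) (q : A) {i a : ℕ} (j : ℕ) (h : i + 1 < a) :
    Commute (T n q i) (ascProd n q a j) := by
  induction j generalizing a with
  | zero => exact Commute.one_right _
  | succ j ih => exact (T_commute n q h).mul_right (ih (by omega))

theorem T_commute_ascProd' (n : ℕ) (q : A) {i a : ℕ} (j : ℕ) (h : a + j < i) :
    Commute (T n q i) (ascProd n q a j) := by
  induction j generalizing a with
  | zero => exact Commute.one_right _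
  | succ j ih => exact (T_commute n q (by omega)).symm.mul_right (ih (by omega))

/-- Conjugation by `T_a ⋯ T_{a+j}` shifts the inner generators by one. -/
theorem ascProd_mul_T (n : ℕ) (q : A) {a j i : ℕ} (h1 : a ≤ i) (h2 : i + 1 < a + j) :
    ascProd n q a j * T n q i = T n q (i + 1) * ascProd n q a j := by
  induction j generalizing a with
  | zero => omega
  | succ j ih =>
    rcases h1.eq_or_lt with rfl | h
    · obtain ⟨j, rfl⟩ : ∃ k, j = k + 1 := ⟨j - 1, by omega⟩
      have hc := (T_commute_ascProd n q j (show a + 1 < a + 1 + 1 by omega)).eq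
      calc T n q a * (T n q (a + 1) * ascProd n q (a + 1 + 1) j) * T n q a
          = T n q a * T n q (a + 1) * T n q a * ascProd n q (a + 1 + 1) j := by
            simp only [mul_assoc, hc]
        _ = _ := by rw [T_braid]; simp only [ascProd, mul_assoc]
    · rw [ascProd, mul_assoc, ih (by omega) (by omega), ← mul_assoc,
        (T_commute n q (show a + 1 < i + 1 by omega)).eq, mul_assoc]

/-- The span of the standard normal forms in `T_1, …, T_{m-1}`. -/
def normalSpan (n : ℕ) (q : A) : ℕ → Submodule A (HeckeAlgebra n q)
  | 0 => Submodule.span A {1}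
  | m + 1 =>
    { carrier := {x | ∃ f : ℕ → HeckeAlgebra n q, (∀ l, f l ∈ normalSpan n q m) ∧
        x = ∑ l ∈ Finset.range (m + 1), ascProd n q (m + 1 - l) l * f l}
      zero_mem' := ⟨0, fun _ => zero_mem _, by simp⟩
      add_mem' := by
        rintro _ _ ⟨f, hf, rfl⟩ ⟨g, hg, rfl⟩
        exact ⟨f + g, fun l => add_mem (hf l) (hg l), by simp [mul_add, Finset.sum_add_distrib]⟩
      smul_mem' := by
        rintro c _ ⟨f, hf, rfl⟩
        exact ⟨c • f, fun l => Submodule.smul_mem _ c (hf l), by simp [Finset.smul_sum]⟩ }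

theorem ascProd_mul_mem (n : ℕ) (q : A) {m l : ℕ} (hl : l ≤ m) {x : HeckeAlgebra n q}
    (hx : x ∈ normalSpan n q m) :
    ascProd n q (m + 1 - l) l * x ∈ normalSpan n q (m + 1) := by
  refine ⟨Pi.single l x, fun k => ?_, ?_⟩
  · by_cases h : k = l
    · subst h; simpa using hx
    · simp [Pi.single_eq_of_ne h]
  · rw [Finset.sum_eq_single l]
    · simp
    · intro k _ hk; simp [Pi.single_eq_of_ne hk]
    · intro h; simp at h; omega

theorem one_mem_normalSpan (n : ℕ) (q : A) (m : ℕ) : 1 ∈ normalSpan n q m := by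
  induction m with
  | zero => exact Submodule.mem_span_singleton_self _
  | succ m ih => simpa [ascProd] using ascProd_mul_mem n q (Nat.zero_le m) ih

/-- There are four cases for T_i against the chain T_{m+1-l} ⋯ T_m. Far below, it commutes past the
chain; just below, it lengthens the chain; equal to the first factor, it is absorbed by the
quadratic relation; further inside, it crosses the chain as T_{i-1}. -/
theorem T_mul_mem_normalSpan (n : ℕ) (q : A) {m i : ℕ} (hi : 1 ≤ i) (him : i < m) (hm : m ≤ n)
    {x : HeckeAlgebra n q} (hx : x ∈ normalSpan n q m) : T n q i * x ∈ normalSpan n q m := by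
  induction m generalizing i x with
  | zero => omega
  | succ m ih =>
    obtain ⟨f, hf, rfl⟩ := hx
    rw [Finset.mul_sum]
    refine Submodule.sum_mem _ fun l hl => ?_
    have hl : l ≤ m := by simpa [Nat.lt_succ_iff] using hl
    rw [← mul_assoc]
    rcases lt_trichotomy (i + l) m with h | h | h
    · rw [(T_commute_ascProd n q l (by omega)).eq, mul_assoc]
      exact ascProd_mul_mem n q hl (ih hi (by omega) (by omega) (hf l))
    · have e : T n q i * ascProd n q (m + 1 - l) l = ascProd n q (m + 1 - (l + 1)) (l + 1) := by
        rw [ascProd]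
        congr 2 <;> omega
      rw [e]
      exact ascProd_mul_mem n q (by omega) (hf l)
    · rcases (show m + 1 - l ≤ i by omega).eq_or_lt with h' | h'
      · obtain ⟨l, rfl⟩ : ∃ k, l = k + 1 := ⟨l - 1, by omega⟩
        have e : T n q i * ascProd n q (m + 1 - (l + 1)) (l + 1) =
            (q - 1) • ascProd n q (m + 1 - (l + 1)) (l + 1) + q • ascProd n q (m + 1 - l) l := by
          rw [ascProd, h', ← mul_assoc, T_sq q hi (by omega),
            show i + 1 = m + 1 - l by omega]
          simp [add_mul]
        rw [e, add_mul, smul_mul_assoc, smul_mul_assoc]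
        exact add_mem (Submodule.smul_mem _ _ (ascProd_mul_mem n q hl (hf _)))
          (Submodule.smul_mem _ _ (ascProd_mul_mem n q (by omega) (hf _)))
      · obtain ⟨i, rfl⟩ : ∃ k, i = k + 1 := ⟨i - 1, by omega⟩
        rw [← ascProd_mul_T n q (by omega) (by omega), mul_assoc]
        exact ascProd_mul_mem n q hl (ih (by omega) (by omega) (by omega) (hf l))

/-- The span contains 1 and is stable under left multiplication by every generator, hence by the
whole algebra. -/
theorem normalSpan_self (n : ℕ) (q : A) (x : HeckeAlgebra n q) : x ∈ normalSpan n q n := by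
  obtain ⟨y, rfl⟩ := RingQuot.mkAlgHom_surjective A (HeckeRel n q) x
  suffices h : ∀ z ∈ normalSpan n q n, mk n q y * z ∈ normalSpan n q n by
    have h1 := h 1 (one_mem_normalSpan n q n)
    rw [mul_one] at h1
    exact h1
  induction y using FreeAlgebra.induction with
  | grade0 r =>
    intro z hz
    rw [AlgHom.commutes, ← Algebra.smul_def]
    exact Submodule.smul_mem _ r hz
  | grade1 i =>
    intro z hz
    have := T_mul_mem_normalSpan n q i.2.1 i.2.2 le_rfl hz
    rwa [T, dif_pos i.2] at this
  | mul a b ha hb =>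
    intro z hz
    rw [map_mul, mul_assoc]
    exact ha _ (hb z hz)
  | add a b ha hb =>
    intro z hz
    rw [map_add, add_mul]
    exact add_mem (ha z hz) (hb z hz)

/-! ### Independence of normal forms and torsion-freeness. -/

theorem wordOp_mapDomain (q : A) {i : ℕ} {x : Perm ℕ →₀ A}
    (hx : ∀ w ∈ x.support, w i < w (i + 1)) :
    wordOp q i x = x.mapDomain (· * swap i (i + 1)) := by
  rw [wordOp, Finsupp.linearCombination_apply, Finsupp.mapDomain]
  refine Finsupp.sum_congr fun w hw => ?_
  simp [hx w hw]

/-- On words supported on permutations of `{0, …, m}`, the operator of the normal form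
`T_{m+1-l} ⋯ T_m` is injective and moves the letter `m + 1` to position `m + 1 - l`. -/
theorem wordRep_ascProd {n : ℕ} (q : A) {m l : ℕ} (hm : m < n) (hl : l ≤ m) {x : Perm ℕ →₀ A}
    (hx : ∀ w ∈ x.support, ∀ j, m < j → w j = j) :
    (∀ w ∈ (wordRep n q (ascProd n q (m + 1 - l) l) x).support,
      w (m + 1 - l) = m + 1 ∧ (∀ j, j < m + 1 - l → w j < m + 1) ∧
        ∀ j, m + 1 < j → w j = j) ∧
    (wordRep n q (ascProd n q (m + 1 - l) l) x = 0 → x = 0) := by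
  classical
  induction l with
  | zero =>
    simp only [ascProd, map_one, Module.End.one_apply, imp_self, and_true]
    refine fun w hw => ⟨hx w hw _ (by omega), fun j hj => ?_, fun j hj => hx w hw j (by omega)⟩
    -- A value above m would itself be a fixed point, against injectivity.
    by_contra h
    have h1 := hx w hw (w j) (by omega)
    have h2 := w.injective h1
    omega
  | succ l ih =>
    obtain ⟨ih1, ih2⟩ := ih (by omega)
    obtain ⟨p, hp⟩ : ∃ p, m + 1 - l = p + 1 := ⟨m - l, by omega⟩
    have hp' : m + 1 - (l + 1) = p := by omega
    rw [hp] at ih1 ih2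
    rw [hp', ascProd, map_mul, Module.End.mul_apply, wordRep_T q (by omega) (by omega)]
    set y := wordRep n q (ascProd n q (p + 1) l) x
    -- The letter m + 1 sits at position p + 1 with only smaller letters to its left, so the
    -- generator acts through its ascending branch, as a mere permutation of the basis.
    rw [wordOp_mapDomain q fun w hw => by
      have h := ih1 w hw
      rw [h.1]
      exact h.2.1 p (by omega)]
    refine ⟨fun w hw => ?_, fun h => ih2 ?_⟩
    · obtain ⟨v, hv, rfl⟩ := Finset.mem_image.1 (Finsupp.mapDomain_support hw)
      obtain ⟨h1, h2, h3⟩ := ih1 v hv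
      refine ⟨by simpa using h1, fun j hj => ?_, fun j hj => ?_⟩
      · simpa [swap_apply_of_ne_of_ne (show j ≠ p by omega) (show j ≠ p + 1 by omega)] using
          h2 j (by omega)
      · simpa [swap_apply_of_ne_of_ne (show j ≠ p by omega) (show j ≠ p + 1 by omega)] using
          h3 j hj
    · exact Finsupp.mapDomain_injective (mul_left_injective _) (h.trans Finsupp.mapDomain_zero.symm)

/-- The support bound is carried along because the induction needs it: it makes the l-th summand put
the letter m + 1 at position m + 1 - l. Different summands then have disjoint supports and cannot
cancel. -/
theorem wordRep_normalSpan {n : ℕ} (q : A) {m : ℕ} (hm : m ≤ n) {x : HeckeAlgebra n q}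
    (hx : x ∈ normalSpan n q m) :
    (∀ w ∈ (wordRep n q x (Finsupp.single 1 1)).support, ∀ j, m < j → w j = j) ∧
    (wordRep n q x (Finsupp.single 1 1) = 0 → x = 0) := by
  classical
  induction m generalizing x with
  | zero =>
    obtain ⟨c, rfl⟩ := Submodule.mem_span_singleton.1 hx
    refine ⟨fun w hw j _ => ?_, fun h => ?_⟩
    · have h1 : w ∈ (Finsupp.single (1 : Perm ℕ) c).support := by simpa using hw
      rw [Finset.mem_singleton.1 (Finsupp.support_single_subset h1)]
      rfl
    · have h1 : Finsupp.single (1 : Perm ℕ) c = 0 := by simpa using h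
      rw [Finsupp.single_eq_zero.1 h1, zero_smul]
  | succ m ih =>
    obtain ⟨f, hf, rfl⟩ := hx
    have key := fun l (hl : l ≤ m) => wordRep_ascProd q (show m < n by omega) hl
      (ih (by omega) (hf l)).1
    simp only [map_sum, map_mul, LinearMap.sum_apply, Module.End.mul_apply]
    refine ⟨fun w hw j hj => ?_, fun h => Finset.sum_eq_zero fun l hl => ?_⟩
    · obtain ⟨l, hl, hw⟩ := Finset.mem_biUnion.1 (Finsupp.support_finsetSum hw)
      exact ((key l (by simpa [Nat.lt_succ_iff] using hl)).1 w hw).2.2 j hj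
    · have hl' : l ≤ m := by simpa [Nat.lt_succ_iff] using hl
      rw [(ih (by omega) (hf l)).2 ((key l hl').2 ?_), mul_zero]
      -- The position of the letter m + 1 in w singles out l, so the coefficient of the whole sum at
      -- w is that of the l-th summand.
      ext w
      by_contra hw
      have hw1 := ((key l hl').1 w (Finsupp.mem_support_iff.2 hw)).1
      refine hw ?_
      have h2 := DFunLike.congr_fun h w
      rw [Finsupp.finsetSum_apply, Finset.sum_eq_single_of_mem l hl] at h2
      · exact h2
      · intro k hk hkl
        have hk' : k ≤ m := by simpa [Nat.lt_succ_iff] using hk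
        by_contra hw'
        have hw2 := ((key k hk').1 w (Finsupp.mem_support_iff.2 hw')).1
        have := w.injective (hw1.trans hw2.symm)
        omega

/-- The Hecke algebra over a domain is torsion-free, for any parameter. -/
theorem eq_zero_of_smul_eq_zero [IsDomain A] {n : ℕ} {q c : A} (hc : c ≠ 0)
    {x : HeckeAlgebra n q} (h : c • x = 0) : x = 0 := by
  refine (wordRep_normalSpan q le_rfl (normalSpan_self n q x)).2 ?_
  have h1 : c • wordRep n q x (Finsupp.single 1 1) = 0 := by
    rw [← LinearMap.smul_apply, ← map_smul, h, map_zero, LinearMap.zero_apply]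
  ext w
  simpa [hc] using DFunLike.congr_fun h1 w

/-! ### Recursions and commutation for the elements B_m. -/

theorem star_smul_hecke {n : ℕ} {q : A} (c : A) (x : HeckeAlgebra n q) :
    star (c • x) = c • star x := by
  rw [Algebra.smul_def, star_mul, star_algebraMap, ← Algebra.commutes, Algebra.smul_def]

theorem B_zero (n : ℕ) (q : A) : B n q 0 = 0 := by simp [B]

theorem B_succ (n : ℕ) (q : A) (m : ℕ) : B n q (m + 1) = 1 + T n q m * B n q m := by
  rw [B, Finset.sum_Icc_succ_top (by omega), B, Finset.mul_sum, add_comm]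
  congr 1
  · simp
  · refine Finset.sum_congr rfl fun i hi => ?_
    rw [List.Ico.succ_top (Finset.mem_Icc.1 hi).2]
    simp

theorem star_B_succ (n : ℕ) (q : A) (m : ℕ) :
    star (B n q (m + 1)) = 1 + star (B n q m) * T n q m := by
  rw [B_succ, star_add, star_one, star_mul, star_T]

theorem commute_B {n : ℕ} {q : A} {x : HeckeAlgebra n q} {m : ℕ}
    (h : ∀ i < m, Commute x (T n q i)) : Commute x (B n q m) := by
  induction m with
  | zero => rw [B_zero]; exact Commute.zero_right _
  | succ m ih =>
    rw [B_succ]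
    exact (Commute.one_right _).add_right
      ((h m (by omega)).mul_right (ih fun i hi => h i (by omega)))

theorem commute_star_B {n : ℕ} {q : A} {x : HeckeAlgebra n q} {m : ℕ}
    (h : ∀ i < m, Commute x (T n q i)) : Commute x (star (B n q m)) := by
  induction m with
  | zero => rw [B_zero, star_zero]; exact Commute.zero_right _
  | succ m ih =>
    rw [star_B_succ]
    exact (Commute.one_right _).add_right
      ((ih fun i hi => h i (by omega)).mul_right (h m (by omega)))

theorem T_commute_lower (n : ℕ) (q : A) {m : ℕ} : ∀ i < m, Commute (T n q (m + 1)) (T n q i) :=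
  fun _ hi => (T_commute n q (by omega)).symm

/-! ### The eigenvector identity for consecutive factors. -/

/-- Partial sums `1 + T_{a+j-1} + T_{a+j-1} T_{a+j-2} + ⋯ + T_{a+j-1} ⋯ T_a`. -/
def descSum (n : ℕ) (q : A) (a : ℕ) : ℕ → HeckeAlgebra n q
  | 0 => 1
  | j + 1 => 1 + T n q (a + j) * descSum n q a j

theorem descSum_one (n : ℕ) (q : A) (m : ℕ) : descSum n q 1 m = B n q (m + 1) := by
  induction m with
  | zero => rw [B_succ, B_zero]; simp [descSum]
  | succ m ih => rw [descSum, ih, B_succ n q (m + 1), add_comm 1 m]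

theorem T_commute_descSum (n : ℕ) (q : A) {a i j : ℕ} (h : a + j < i) :
    Commute (T n q i) (descSum n q a j) := by
  induction j with
  | zero => exact Commute.one_right _
  | succ j ih =>
    exact (Commute.one_right _).add_right
      ((T_commute n q (by omega)).symm.mul_right (ih (by omega)))

/-- With D_j the partial sums, u = T_{a+j} and v = T_{a+j+1}, one has D_{j+1} D_{j+2} = (1 + v)
D_{j+1} + u v D_j D_{j+1}. Left multiplication by v scales both terms by q: the first by the
quadratic relation, the second by v u v = u v u and induction. -/
theorem T_mul_descSum_mul {n : ℕ} (q : A) {a j : ℕ} (ha : 1 ≤ a) (h : a + j < n) :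
    T n q (a + j) * (descSum n q a j * descSum n q a (j + 1)) =
      q • (descSum n q a j * descSum n q a (j + 1)) := by
  induction j with
  | zero =>
    simp only [descSum, mul_one, one_mul, add_zero, mul_add, T_sq q ha h]
    module
  | succ j ih =>
    have ih := ih (by omega)
    have hsq := T_sq q (show 1 ≤ a + (j + 1) by omega) h
    have hc := (T_commute_descSum n q (show a + j < a + (j + 1) by omega)).eq
    have hb := T_braid n q (a + j)
    rw [add_assoc] at hb
    set u := T n q (a + j)
    set v := T n q (a + (j + 1))
    have hd1 : descSum n q a (j + 1) = 1 + u * descSum n q a j := rfl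
    have hd2 : descSum n q a (j + 1 + 1) = 1 + v * descSum n q a (j + 1) := rfl
    have e : descSum n q a (j + 1) * descSum n q a (j + 1 + 1) =
        (1 + v) * descSum n q a (j + 1) +
          u * v * (descSum n q a j * descSum n q a (j + 1)) := by
      rw [hd2]
      set d := descSum n q a (j + 1)
      have h1 : d * (v * d) = v * d + u * (descSum n q a j * v) * d := by
        have h2 : d * (v * d) = (1 + u * descSum n q a j) * (v * d) := congrArg (· * (v * d)) hd1
        rw [h2]
        noncomm_ring
      rw [mul_add, h1, ← hc]
      noncomm_ring
    have e2 : v * (u * v * (descSum n q a j * descSum n q a (j + 1))) =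
        q • (u * v * (descSum n q a j * descSum n q a (j + 1))) := by
      rw [← mul_smul_comm, ← ih, ← mul_assoc, ← mul_assoc, ← mul_assoc v, ← hb]
      simp only [mul_assoc]
    have e3 : v * ((1 + v) * descSum n q a (j + 1)) = q • ((1 + v) * descSum n q a (j + 1)) := by
      rw [← mul_assoc, mul_add, hsq, ← smul_mul_assoc]
      congr 1
      rw [mul_one]
      module
    rw [e, mul_add, e2, e3, smul_add]

theorem T_mul_B_mul_B {n : ℕ} (q : A) {m : ℕ} (h : m < n) :
    T n q m * (B n q m * B n q (m + 1)) = q • (B n q m * B n q (m + 1)) := by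
  cases m with
  | zero => simp [B_zero]
  | succ m =>
    have := T_mul_descSum_mul q le_rfl (show 1 + m < n by omega)
    rwa [descSum_one, descSum_one, add_comm 1 m] at this

/-! ### Jucys–Murphy elements and the product of B with its adjoint. -/

/-- The rescaled Jucys–Murphy element `∑_{i<m} q^{i-1} T_{(i,m)}`. -/
def jucysMurphy (n : ℕ) (q : A) : ℕ → HeckeAlgebra n q
  | 0 => 0
  | m + 1 => T n q m * jucysMurphy n q m * T n q m + q ^ (m - 1) • T n q m

theorem star_jucysMurphy (n : ℕ) (q : A) (m : ℕ) :
    star (jucysMurphy n q m) = jucysMurphy n q m := by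
  induction m with
  | zero => exact star_zero _
  | succ m ih =>
    rw [jucysMurphy, star_add, star_mul, star_mul, star_smul_hecke, ih, star_T, mul_assoc]

theorem commute_jucysMurphy {n : ℕ} {q : A} {x : HeckeAlgebra n q} {m : ℕ}
    (h : ∀ i < m, Commute x (T n q i)) : Commute x (jucysMurphy n q m) := by
  induction m with
  | zero => exact Commute.zero_right _
  | succ m ih =>
    have hm := h m (by omega)
    exact ((hm.mul_right (ih fun i hi => h i (by omega))).mul_right hm).add_right
      (hm.smul_right _)

/-- Only the topmost T_i is not covered by induction. Unfolding the recursion twice leaves v u L u v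
and a multiple of v u v + q v, with u = T_i, v = T_{i+1} and L = J_i. Each commutes with u, by the
braid relation and, for the second, also the quadratic one. -/
theorem jucysMurphy_commute_T {n : ℕ} (q : A) {m : ℕ} (hm : m ≤ n) :
    ∀ i < m, Commute (jucysMurphy n q (m + 1)) (T n q i) := by
  induction m with
  | zero => intro i hi; omega
  | succ m ih =>
    intro i hi
    rcases (Nat.lt_succ_iff.1 hi).lt_or_eq with h | rfl
    · have h1 := (T_commute n q (show i + 1 < m + 1 by omega)).symm
      exact ((h1.mul_left (ih (by omega) i h)).mul_left h1).add_left (h1.smul_left _)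
    · rcases Nat.eq_zero_or_pos i with rfl | hi0
      · rw [T_of_not q (by omega : ¬(1 ≤ 0 ∧ 0 < n))]; exact Commute.zero_right _
      have hb := T_braid n q i
      have hc := (commute_jucysMurphy (T_commute_lower n q (m := i))).eq
      have hsq := T_sq q hi0 (show i < n by omega)
      obtain ⟨k, rfl⟩ : ∃ k, i = k + 1 := ⟨i - 1, by omega⟩
      have e : jucysMurphy n q (k + 1 + 1 + 1) =
          T n q (k + 1 + 1) * (T n q (k + 1) * jucysMurphy n q (k + 1) * T n q (k + 1) +
            q ^ k • T n q (k + 1)) * T n q (k + 1 + 1) + q ^ (k + 1) • T n q (k + 1 + 1) := rfl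
      rw [e]
      set u := T n q (k + 1)
      set v := T n q (k + 1 + 1)
      set L := jucysMurphy n q (k + 1)
      have c1 : Commute (v * (u * L * u) * v) u := by
        change v * (u * L * u) * v * u = u * (v * (u * L * u) * v)
        calc v * (u * L * u) * v * u = v * u * L * (u * v * u) := by noncomm_ring
          _ = v * u * (v * L) * u * v := by rw [hb, hc]; noncomm_ring
          _ = (v * u * v) * (L * u * v) := by noncomm_ring
          _ = _ := by rw [← hb]; noncomm_ring
      have c2 : Commute (v * u * v + q • v) u := by
        change (v * u * v + q • v) * u = u * (v * u * v + q • v)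
        rw [← hb]
        have h1 : u * v * u * u = u * v * (u * u) := by noncomm_ring
        have h2 : u * (u * v * u) = (u * u) * (v * u) := by noncomm_ring
        rw [add_mul, mul_add, h1, h2, hsq]
        simp only [mul_add, add_mul, smul_mul_assoc, mul_smul_comm, mul_one, one_mul, mul_assoc]
        abel
      have e2 : v * (u * L * u + q ^ k • u) * v + q ^ (k + 1) • v =
          v * (u * L * u) * v + q ^ k • (v * u * v + q • v) := by
        simp only [mul_add, add_mul, smul_mul_assoc, mul_smul_comm, smul_add, smul_smul, pow_succ]
        abel
      rw [e2]
      exact c1.add_left (c2.smul_left _)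

theorem qInt_succ (q : A) (m : ℕ) : qInt q (m + 1) = qInt q m + q ^ m :=
  Finset.sum_range_succ _ _

theorem qInt_mul_sub_one (q : A) (m : ℕ) : qInt q m * (q - 1) = q ^ m - 1 := geom_sum_mul q m

/-- Expand with B_{m+1} = 1 + T_m B_m and induct. The braid relation turns the conjugated inner term
into (B*_m - 1) T_m (B_m - 1), whose linear terms cancel T_m B_m and B*_m T_m. -/
theorem B_mul_star_B {n : ℕ} (q : A) {m : ℕ} (hm : m < n) :
    B n q (m + 1) * star (B n q (m + 1)) =
      star (B n q m) * T n q m * B n q m + qInt q (m + 1) • 1 +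
        q • jucysMurphy n q (m + 1) := by
  induction m with
  | zero =>
    have h0 : T n q 0 = 0 := T_of_not q (by omega)
    simp [B_succ, B_zero, h0, jucysMurphy, qInt]
  | succ m ih =>
    have ih := ih (by omega)
    have hB := B_succ n q m
    have hS := star_B_succ n q m
    have hb := T_braid n q m
    have hsq := T_sq q (show 1 ≤ m + 1 by omega) hm
    have hc1 := (commute_B (T_commute_lower n q (m := m))).eq
    have hc2 := (commute_star_B (T_commute_lower n q (m := m))).eq
    rw [star_B_succ n q (m + 1), B_succ n q (m + 1), jucysMurphy, Nat.add_sub_cancel]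
    set b := B n q (m + 1)
    set b' := B n q m
    set t := T n q (m + 1)
    set t' := T n q m
    set L := jucysMurphy n q (m + 1)
    have h1 : t * (star b' * t' * b') * t = (star b - 1) * t * (b - 1) := by
      calc t * (star b' * t' * b') * t = (t * star b') * t' * (b' * t) := by noncomm_ring
        _ = star b' * (t * t' * t) * b' := by rw [hc2, ← hc1]; noncomm_ring
        _ = _ := by rw [← hb, hS, hB]; noncomm_ring
    have h2 : (1 + t * b) * (1 + star b * t) =
        1 + t * b + star b * t + t * (b * star b) * t := by noncomm_ring
    rw [h2, ih, mul_add, mul_add, add_mul, add_mul, h1]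
    simp only [mul_smul_comm, smul_mul_assoc, mul_one, hsq, smul_add, smul_smul, mul_assoc,
      sub_mul, mul_sub, one_mul]
    have e1 : qInt q (m + 1 + 1) = 1 + qInt q (m + 1) * q := by
      linear_combination qInt_succ q (m + 1) - qInt_mul_sub_one q (m + 1)
    have e2 : q * q ^ m = 1 + qInt q (m + 1) * (q - 1) := by
      linear_combination -qInt_mul_sub_one q (m + 1)
    rw [e1, e2]
    module

/-! ### The exchange rule and commutativity. -/

/-- The unnormalized shuffle `B_m^* ⋯ B_{m-k+1}^* B_{m-k+1} ⋯ B_m`. -/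
def shuffle (n : ℕ) (q : A) : ℕ → ℕ → HeckeAlgebra n q
  | _, 0 => 1
  | 0, _ + 1 => 0
  | m + 1, k + 1 => star (B n q (m + 1)) * shuffle n q m k * B n q (m + 1)

theorem shuffle_zero_right (n : ℕ) (q : A) (m : ℕ) : shuffle n q m 0 = 1 := by
  cases m <;> rfl

theorem shuffle_succ (n : ℕ) (q : A) (m k : ℕ) : shuffle n q (m + 1) (k + 1) =
    star (B n q (m + 1)) * shuffle n q m k * B n q (m + 1) := rfl

theorem star_shuffle (n : ℕ) (q : A) (m k : ℕ) :
    star (shuffle n q m k) = shuffle n q m k := by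
  induction m generalizing k with
  | zero => cases k <;> simp [shuffle]
  | succ m ih => cases k <;> simp [shuffle, ih, mul_assoc]

theorem commute_shuffle {n : ℕ} {q : A} {x : HeckeAlgebra n q} {m : ℕ} (k : ℕ)
    (h : ∀ i < m, Commute x (T n q i)) : Commute x (shuffle n q m k) := by
  induction m generalizing k with
  | zero =>
    cases k with
    | zero => exact Commute.one_right _
    | succ k => exact Commute.zero_right _
  | succ m ih =>
    cases k with
    | zero => exact Commute.one_right _
    | succ k =>
      exact ((commute_star_B h).mul_right (ih k fun i hi => h i (by omega))).mul_right
        (commute_B h)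

-- Expand B_{m+1} B*_{m+1} and apply induction to the inner product of B_m with a shuffle. The
-- existential scalars suffice, as commutativity never uses their values.
set_option maxHeartbeats 1000000 in
theorem B_mul_shuffle {n : ℕ} (q : A) (k : ℕ) {m : ℕ} (hm : m < n) :
    ∃ (s : ℕ) (α β γ : A), q ^ s • (B n q (m + 1) * shuffle n q (m + 1) (k + 1)) =
      (γ • shuffle n q m (k + 1) + (α • 1 + β • jucysMurphy n q (m + 1)) * shuffle n q m k) *
        B n q (m + 1) := by
  induction k generalizing m with
  | zero =>
    refine ⟨0, qInt q (m + 1), q, q, ?_⟩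
    have h1 := B_mul_star_B q hm
    have h2 : star (B n q m) * T n q m * B n q m * B n q (m + 1) =
        q • (shuffle n q m 1 * B n q (m + 1)) := by
      cases m with
      | zero => simp [B_zero, shuffle]
      | succ m =>
        rw [mul_assoc, mul_assoc, T_mul_B_mul_B q hm, shuffle_succ, shuffle_zero_right]
        simp only [mul_smul_comm, mul_one, mul_assoc]
    rw [shuffle_succ, shuffle_zero_right, mul_one, mul_one, ← mul_assoc, h1, add_mul, add_mul, h2]
    simp only [pow_zero, one_smul, add_mul, smul_mul_assoc]
    abel
  | succ k ih =>
    cases m with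
    -- Both sides vanish, so any constants serve.
    | zero => exact ⟨0, 0, 0, 0, by simp [shuffle]⟩
    | succ m =>
      obtain ⟨s, α, β, γ, ih⟩ := ih (show m < n by omega)
      have h1 := B_mul_star_B q hm
      have hbb := T_mul_B_mul_B q hm
      have hL : jucysMurphy n q (m + 1 + 1) = T n q (m + 1) * jucysMurphy n q (m + 1) *
        T n q (m + 1) + q ^ m • T n q (m + 1) := rfl
      have hA := (commute_shuffle (k + 1) (T_commute_lower n q (m := m))).eq
      have hB := (commute_shuffle k (T_commute_lower n q (m := m))).eq
      have hLb := (commute_star_B (jucysMurphy_commute_T q hm.le)).eq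
      have hP1 := shuffle_succ n q m (k + 1)
      have hP2 := shuffle_succ n q m k
      -- Coefficients read off from `e4` and `e6`; the new factor q is the price of `e3`.
      refine ⟨s + 1, q ^ 2 * α - β * q ^ (m + 1) + q ^ (s + 1) * qInt q (m + 1 + 1),
        β + q ^ (s + 2), q ^ 2 * γ, ?_⟩
      rw [shuffle_succ n q (m + 1) (k + 1)]
      set b := B n q (m + 1)
      set c := B n q (m + 1 + 1)
      set t := T n q (m + 1)
      set L := jucysMurphy n q (m + 1)
      set L' := jucysMurphy n q (m + 1 + 1)
      set P1 := shuffle n q m (k + 1)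
      set P2 := shuffle n q m k
      set Q1 := shuffle n q (m + 1) (k + 1 + 1)
      set Q2 := shuffle n q (m + 1) (k + 1)
      have e1 : star b * t * (P1 * b) * c = q • (Q1 * c) := by
        calc star b * t * (P1 * b) * c = star b * (t * P1) * (b * c) := by noncomm_ring
          _ = star b * P1 * (t * (b * c)) := by rw [hA]; noncomm_ring
          _ = _ := by rw [hbb, hP1, mul_smul_comm]; congr 1; noncomm_ring
      have e2 : star b * t * (P2 * b) * c = q • (Q2 * c) := by
        calc star b * t * (P2 * b) * c = star b * (t * P2) * (b * c) := by noncomm_ring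
          _ = star b * P2 * (t * (b * c)) := by rw [hB]; noncomm_ring
          _ = _ := by rw [hbb, hP2, mul_smul_comm]; congr 1; noncomm_ring
      -- The recursion for L' needs t on both sides of L. The factor q supplies the missing one,
      -- since q b c = t b c.
      have e3 : q • (star b * t * (L * P2 * b) * c) = L' * Q2 * c - q ^ (m + 1) • (Q2 * c) := by
        calc q • (star b * t * (L * P2 * b) * c)
            = star b * t * L * P2 * (q • (b * c)) := by
              rw [mul_smul_comm]; congr 1; noncomm_ring
          _ = star b * t * L * (P2 * t) * (b * c) := by rw [← hbb]; noncomm_ring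
          _ = star b * (t * L * t) * P2 * (b * c) := by rw [← hB]; noncomm_ring
          _ = star b * (L' - q ^ m • t) * P2 * (b * c) := by rw [hL, add_sub_cancel_right]
          _ = L' * star b * P2 * b * c - q ^ m • (star b * t * (P2 * b) * c) := by
              rw [hLb, mul_sub, sub_mul, sub_mul, mul_smul_comm, smul_mul_assoc, smul_mul_assoc]
              congr 1
              · noncomm_ring
              · congr 1; noncomm_ring
          _ = _ := by
              rw [e2, hP2, smul_smul, pow_succ]
              congr 1; noncomm_ring
      have e4 : c * (star c * Q2 * c) = star b * t * (b * Q2) * c +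
          qInt q (m + 1 + 1) • (Q2 * c) + q • (L' * Q2 * c) := by
        have : c * (star c * Q2 * c) = (c * star c) * (Q2 * c) := by noncomm_ring
        rw [this, h1, add_mul, add_mul, smul_mul_assoc, smul_mul_assoc, one_mul]
        congr 1
        · congr 1; noncomm_ring
        · congr 1; noncomm_ring
      have e5 : q ^ s • (star b * t * (b * Q2) * c) =
          γ • q • (Q1 * c) + α • q • (Q2 * c) + β • (star b * t * (L * P2 * b) * c) := by
        have : q ^ s • (star b * t * (b * Q2) * c) = star b * t * (q ^ s • (b * Q2)) * c := by
          rw [mul_smul_comm, smul_mul_assoc]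
        rw [this, ih, ← e1, ← e2]
        simp only [add_mul, mul_add, smul_mul_assoc, mul_smul_comm, one_mul]
        abel
      have e6 : q ^ (s + 1) • (star b * t * (b * Q2) * c) =
          γ • q • q • (Q1 * c) + α • q • q • (Q2 * c) +
            β • (L' * Q2 * c - q ^ (m + 1) • (Q2 * c)) := by
        rw [pow_succ', mul_smul, e5, ← e3]
        module
      rw [e4, smul_add, smul_add, e6]
      simp only [add_mul, smul_mul_assoc, one_mul]
      module

/-- The exchange rule and its adjoint carry the left factor P(m+1,i+1) across B*_{m+1} as W, past
P(m,j), and back out across B_{m+1}. The hypothesis `hq` cancels the power of q. -/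
theorem shuffle_commute {n : ℕ} (q : A)
    (hq : ∀ (s : ℕ) (x : HeckeAlgebra n q), q ^ s • x = 0 → x = 0) {m : ℕ} (hm : m ≤ n)
    (i j : ℕ) : Commute (shuffle n q m i) (shuffle n q m j) := by
  induction m generalizing i j with
  | zero =>
    cases i with
    | zero => exact Commute.one_left _
    | succ i => exact Commute.zero_left _
  | succ m ih =>
    cases i with
    | zero => exact Commute.one_left _
    | succ i =>
    cases j with
    | zero => exact Commute.one_right _
    | succ j =>
      have ih := ih (by omega)
      obtain ⟨s, α, β, γ, h⟩ := B_mul_shuffle q i (show m < n by omega)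
      have hL := fun k => commute_shuffle k (jucysMurphy_commute_T q (show m ≤ n by omega))
      set W := γ • shuffle n q m (i + 1) +
        (α • 1 + β • jucysMurphy n q (m + 1)) * shuffle n q m i with hWdef
      have hW : Commute W (shuffle n q m j) :=
        ((ih _ _).smul_left _).add_left
          ((((Commute.one_left _).smul_left _).add_left ((hL j).smul_left _)).mul_left (ih _ _))
      have hWs : star W = W := by
        have h1 : Commute (shuffle n q m i) (α • 1 + β • jucysMurphy n q (m + 1)) :=
          ((Commute.one_right _).smul_right _).add_right ((hL i).symm.smul_right _)
        rw [hWdef, star_add, star_mul, star_add, star_smul_hecke, star_smul_hecke,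
          star_smul_hecke, star_one, star_shuffle, star_shuffle, star_jucysMurphy, h1.eq]
      have h' : q ^ s • (shuffle n q (m + 1) (i + 1) * star (B n q (m + 1))) =
          star (B n q (m + 1)) * W := by
        have := congrArg star h
        rwa [star_smul_hecke, star_mul, star_mul, hWs, star_shuffle] at this
      rw [commute_iff_eq, ← sub_eq_zero]
      refine hq s _ ?_
      rw [smul_sub, sub_eq_zero]
      calc q ^ s • (shuffle n q (m + 1) (i + 1) * shuffle n q (m + 1) (j + 1))
          = q ^ s • (shuffle n q (m + 1) (i + 1) * star (B n q (m + 1))) *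
              (shuffle n q m j * B n q (m + 1)) := by
            rw [shuffle_succ n q m j, smul_mul_assoc]; congr 1; noncomm_ring
        _ = star (B n q (m + 1)) * (W * shuffle n q m j) * B n q (m + 1) := by
            rw [h']; noncomm_ring
        _ = star (B n q (m + 1)) * shuffle n q m j * (W * B n q (m + 1)) := by
            rw [hW.eq]; noncomm_ring
        _ = _ := by
            rw [← h, shuffle_succ n q m j, mul_smul_comm]; congr 1; noncomm_ring

/-! ### Divisibility by the q-factorial. -/

/-- The product `B_{m-k+1} ⋯ B_m`. -/
def bottomProd (n : ℕ) (q : A) (m k : ℕ) : HeckeAlgebra n q :=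
  ((List.range k).reverse.map fun j => B n q (m - j)).prod

theorem bottomProd_zero (n : ℕ) (q : A) (m : ℕ) : bottomProd n q m 0 = 1 := by
  simp [bottomProd]

theorem bottomProd_succ (n : ℕ) (q : A) (m k : ℕ) :
    bottomProd n q (m + 1) (k + 1) = bottomProd n q m k * B n q (m + 1) := by
  simp only [bottomProd, List.range_succ_eq_map, List.reverse_cons, List.map_append,
    List.prod_append, ← List.map_reverse, List.map_map]
  simp [Function.comp_def]

theorem bottomProd_zero_succ (n : ℕ) (q : A) (k : ℕ) : bottomProd n q 0 (k + 1) = 0 := by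
  simp [bottomProd, List.range_succ_eq_map, B_zero]

theorem star_bottomProd_mul (n : ℕ) (q : A) (m k : ℕ) :
    star (bottomProd n q m k) * bottomProd n q m k = shuffle n q m k := by
  induction m generalizing k with
  | zero => cases k <;> simp [bottomProd_zero, bottomProd_zero_succ, shuffle]
  | succ m ih =>
    cases k with
    | zero => simp [bottomProd_zero, shuffle]
    | succ k =>
      rw [bottomProd_succ, shuffle_succ, star_mul, ← ih]
      noncomm_ring

theorem randomToBottom_mul_bottomToRandom (n : ℕ) (q : A) (k : ℕ) :
    randomToBottom n q k * bottomToRandom n q k = shuffle n q n k :=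
  star_bottomProd_mul n q n k

/-- The sum of the elements which move a `k`-subset of the `a + k` positions to the bottom,
keeping the order. -/
def subsetShuffle (n : ℕ) (q : A) : ℕ → ℕ → HeckeAlgebra n q
  | 0, _ => 1
  | _ + 1, 0 => 1
  | a + 1, k + 1 => subsetShuffle n q (a + 1) k +
      ascProd n q (a + 1) (k + 1) * subsetShuffle n q a (k + 1)

theorem subsetShuffle_zero_right (n : ℕ) (q : A) (a : ℕ) : subsetShuffle n q a 0 = 1 := by
  cases a <;> simp [subsetShuffle]

theorem ascProd_mul_descSum (n : ℕ) (q : A) {a j i : ℕ} (h : i ≤ j) :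
    ascProd n q a (j + 1) * descSum n q a i = descSum n q (a + 1) i * ascProd n q a (j + 1) := by
  induction i with
  | zero => simp [descSum]
  | succ i ih =>
    rw [descSum, descSum, mul_add, add_mul, mul_one, one_mul, ← mul_assoc,
      ascProd_mul_T n q (by omega) (by omega), mul_assoc, ih (by omega), mul_assoc, add_right_comm]

theorem T_commute_subsetShuffle (n : ℕ) (q : A) {a k i : ℕ} (h : a + k < i) :
    Commute (T n q i) (subsetShuffle n q a k) := by
  induction a generalizing k with
  | zero => simp only [subsetShuffle]; exact Commute.one_right _
  | succ a iha =>
    induction k with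
    | zero => rw [subsetShuffle_zero_right]; exact Commute.one_right _
    | succ k ihk =>
      rw [subsetShuffle]
      refine (ihk (by omega)).add_right ?_
      have h1 := T_commute_ascProd' n q (k + 1) (show a + 1 + (k + 1) < i by omega)
      exact h1.mul_right (iha (by omega))

/-- This is the inductive step of `bottomProd_eq`: a new factor B on the right becomes a factor of
the parabolic sum on the left. In the double induction the top generator commutes past the smaller
subset sums and lengthens the ascending chain, which then shifts the partial sum's indices by one.
-/
theorem subsetShuffle_mul_B (n : ℕ) (q : A) (a k : ℕ) :
    subsetShuffle n q a k * B n q (a + k + 1) =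
      descSum n q (a + 1) k * subsetShuffle n q a (k + 1) := by
  induction a generalizing k with
  | zero => rw [subsetShuffle, subsetShuffle, one_mul, mul_one, zero_add, zero_add, descSum_one]
  | succ a iha =>
    induction k with
    | zero =>
      have h := iha 0
      rw [subsetShuffle_zero_right, one_mul] at h
      rw [subsetShuffle_zero_right, one_mul, descSum, one_mul, subsetShuffle,
        subsetShuffle_zero_right, B_succ]
      simp only [descSum, one_mul, add_zero, zero_add] at h ⊢
      rw [h]
      simp [ascProd]
    | succ k ihk =>
      have h1 := iha (k + 1)
      have e1 : a + 1 + (k + 1) + 1 = (a + 1 + k + 1) + 1 := by omega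
      have e2 : a + (k + 1) + 1 = a + 1 + k + 1 := by omega
      have e3 : a + 1 + 1 + k = a + 1 + k + 1 := by omega
      have e4 : a + 1 + (k + 1) = a + 1 + k + 1 := by omega
      rw [e2] at h1
      have hC : ascProd n q (a + 1) (k + 1 + 1) =
          ascProd n q (a + 1) (k + 1) * T n q (a + 1 + k + 1) := by rw [ascProd_succ', e4]
      have hD := ascProd_mul_descSum n q (a := a + 1) (le_refl (k + 1))
      have hd : descSum n q (a + 1 + 1) (k + 1) =
        1 + T n q (a + 1 + k + 1) * descSum n q (a + 1 + 1) k := by rw [descSum, e3]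
      have hu1 : subsetShuffle n q (a + 1) (k + 1) = subsetShuffle n q (a + 1) k +
        ascProd n q (a + 1) (k + 1) * subsetShuffle n q a (k + 1) := by rw [subsetShuffle]
      have hu2 : subsetShuffle n q (a + 1) (k + 1 + 1) = subsetShuffle n q (a + 1) (k + 1) +
        ascProd n q (a + 1) (k + 1 + 1) * subsetShuffle n q a (k + 1 + 1) := by
        rw [subsetShuffle]
      have hc1 : subsetShuffle n q (a + 1) k * T n q (a + 1 + k + 1) =
          T n q (a + 1 + k + 1) * subsetShuffle n q (a + 1) k :=
        (T_commute_subsetShuffle n q (by omega)).symm.eq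
      have hc2 : subsetShuffle n q a (k + 1) * T n q (a + 1 + k + 1) =
          T n q (a + 1 + k + 1) * subsetShuffle n q a (k + 1) :=
        (T_commute_subsetShuffle n q (by omega)).symm.eq
      rw [e1, B_succ n q (a + 1 + k + 1), mul_add, mul_one, ← mul_assoc]
      have hs : subsetShuffle n q (a + 1) (k + 1) * T n q (a + 1 + k + 1) =
          T n q (a + 1 + k + 1) * subsetShuffle n q (a + 1) k +
            ascProd n q (a + 1) (k + 1 + 1) * subsetShuffle n q a (k + 1) := by
        rw [hu1, add_mul, hc1, mul_assoc, hc2, hC, mul_assoc]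
      rw [hs, add_mul, mul_assoc, mul_assoc, ihk, h1, ← mul_assoc (ascProd _ _ _ _), hD, hu2,
        mul_add, mul_assoc]
      have : descSum n q (a + 1 + 1) (k + 1) * subsetShuffle n q (a + 1) (k + 1) =
          subsetShuffle n q (a + 1) (k + 1) + T n q (a + 1 + k + 1) *
            (descSum n q (a + 1 + 1) k * subsetShuffle n q (a + 1) (k + 1)) := by
        rw [hd, add_mul, one_mul, mul_assoc]
      rw [this, ← add_assoc]

/-- The product `∏_{j<k} (1 + T_{a+j-1} + ⋯)`, the sum of all `T_w` over a parabolic `S_k`. -/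
def parabolicSum (n : ℕ) (q : A) (a : ℕ) : ℕ → HeckeAlgebra n q
  | 0 => 1
  | k + 1 => parabolicSum n q a k * descSum n q a k

theorem bottomProd_eq (n : ℕ) (q : A) (a k : ℕ) :
    bottomProd n q (a + k) k = parabolicSum n q (a + 1) k * subsetShuffle n q a k := by
  induction k with
  | zero => simp [bottomProd_zero, parabolicSum, subsetShuffle_zero_right]
  | succ k ih =>
    rw [← add_assoc, bottomProd_succ, ih, mul_assoc, subsetShuffle_mul_B, parabolicSum, mul_assoc]

theorem T_commute_parabolicSum (n : ℕ) (q : A) {a k i : ℕ} (h : a + k ≤ i) :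
    Commute (T n q i) (parabolicSum n q a k) := by
  induction k with
  | zero => exact Commute.one_right _
  | succ k ih => exact (ih (by omega)).mul_right (T_commute_descSum n q (by omega))

/-- For the last generator, commute it past the earlier factors and apply `T_mul_descSum_mul` to the
final two. -/
theorem T_mul_parabolicSum {n : ℕ} (q : A) {a k i : ℕ} (ha : 1 ≤ a) (hn : a + k ≤ n + 1)
    (hi : i + 1 < k) :
    T n q (a + i) * parabolicSum n q a k = q • parabolicSum n q a k := by
  induction k with
  | zero => omega
  | succ k ih =>
    rcases (Nat.lt_succ_iff.1 hi).lt_or_eq with h | rfl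
    · rw [parabolicSum, ← mul_assoc, ih (by omega) h, smul_mul_assoc]
    · rw [parabolicSum, parabolicSum, mul_assoc, ← mul_assoc,
        (T_commute_parabolicSum n q le_rfl).eq, mul_assoc, T_mul_descSum_mul q ha (by omega),
        mul_smul_comm]

theorem star_descSum_mul {n : ℕ} {q : A} {a j : ℕ} {x : HeckeAlgebra n q}
    (h : ∀ i < j, T n q (a + i) * x = q • x) :
    star (descSum n q a j) * x = qInt q (j + 1) • x := by
  induction j with
  | zero => simp [descSum, qInt]
  | succ j ih =>
    rw [descSum, star_add, star_one, star_mul, star_T, add_mul, one_mul, mul_assoc,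
      h j (by omega), mul_smul_comm, ih fun i hi => h i (by omega)]
    have e : qInt q (j + 1 + 1) = 1 + q * qInt q (j + 1) := by
      linear_combination qInt_succ q (j + 1) - qInt_mul_sub_one q (j + 1)
    rw [e]
    module

theorem qFactorial_succ (q : A) (k : ℕ) :
    qFactorial q (k + 1) = qFactorial q k * qInt q (k + 1) :=
  Finset.prod_Icc_succ_top (by omega) _

theorem star_parabolicSum_mul {n : ℕ} {q : A} {a k : ℕ} {x : HeckeAlgebra n q}
    (h : ∀ i, i + 1 < k → T n q (a + i) * x = q • x) :
    star (parabolicSum n q a k) * x = qFactorial q k • x := by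
  induction k with
  | zero => simp [parabolicSum, qFactorial]
  | succ k ih =>
    rw [parabolicSum, star_mul, mul_assoc, ih fun i hi => h i (by omega), mul_smul_comm,
      star_descSum_mul fun i hi => h i (by omega), smul_smul, qFactorial_succ]

theorem exists_qFactorial_smul_eq_shuffle (n : ℕ) (q : A) (k : ℕ) :
    ∃ r, qFactorial q k • r = shuffle n q n k := by
  rcases le_or_gt k n with h | h
  · obtain ⟨a, rfl⟩ := Nat.exists_eq_add_of_le' h
    refine ⟨star (subsetShuffle (a + k) q a k) * parabolicSum (a + k) q (a + 1) k *
      subsetShuffle (a + k) q a k, ?_⟩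
    rw [← star_bottomProd_mul, bottomProd_eq, star_mul, mul_assoc, mul_assoc,
      ← mul_assoc (star (parabolicSum _ _ _ _)), star_parabolicSum_mul fun i hi =>
        T_mul_parabolicSum q (by omega) ?_ hi, smul_mul_assoc, mul_smul_comm]
    omega
  · refine ⟨0, ?_⟩
    -- When k exceeds m, the recursion runs down to level 0 with factors still to take, where the
    -- shuffle is 0.
    have key : ∀ m k, m < k → shuffle n q m k = 0 := by
      intro m
      induction m with
      | zero =>
        intro k hk
        obtain ⟨k, rfl⟩ : ∃ j, k = j + 1 := ⟨k - 1, by omega⟩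
        rfl
      | succ m ih =>
        intro k hk
        obtain ⟨k, rfl⟩ : ∃ j, k = j + 1 := ⟨k - 1, by omega⟩
        rw [shuffle_succ, ih k (by omega), mul_zero, zero_mul]
    rw [key n k h, smul_zero]

/-! ### The quotient over ℤ[X]. -/

theorem qFactorial_X_ne_zero (k : ℕ) : qFactorial (Polynomial.X : Polynomial ℤ) k ≠ 0 := by
  refine Finset.prod_ne_zero_iff.2 fun i hi h => ?_
  -- At X = 1 the q-integer [i] becomes i, which is nonzero.
  have h1 := congrArg (Polynomial.eval 1) h
  simp only [qInt, Polynomial.eval_finsetSum, Polynomial.eval_pow, Polynomial.eval_X, one_pow,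
    Polynomial.eval_zero, Finset.sum_const, Finset.card_range, nsmul_eq_mul, mul_one] at h1
  have := (Finset.mem_Icc.1 hi).1
  omega

theorem smul_left_cancel_X {n : ℕ} {c : Polynomial ℤ} (hc : c ≠ 0)
    {x y : HeckeAlgebra n (Polynomial.X : Polynomial ℤ)} (h : c • x = c • y) : x = y :=
  sub_eq_zero.1 (eq_zero_of_smul_eq_zero hc (by rw [smul_sub, h, sub_self]))

theorem existsUnique_isGenericRandomToRandom (n k : ℕ) :
    ∃! r : HeckeAlgebra n (Polynomial.X : Polynomial ℤ), IsGenericRandomToRandom n k r := by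
  obtain ⟨r, hr⟩ := exists_qFactorial_smul_eq_shuffle n (Polynomial.X : Polynomial ℤ) k
  refine ⟨r, ?_, fun y hy => ?_⟩
  · exact hr.trans (randomToBottom_mul_bottomToRandom n _ k).symm
  · exact smul_left_cancel_X (qFactorial_X_ne_zero k)
      ((hy.trans (randomToBottom_mul_bottomToRandom n _ k)).trans hr.symm)

theorem qFactorial_smul_genericRandomToRandom (n k : ℕ) :
    qFactorial (Polynomial.X : Polynomial ℤ) k • genericRandomToRandom n k =
      shuffle n Polynomial.X n k := by
  rw [← randomToBottom_mul_bottomToRandom]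
  exact Classical.epsilon_spec (existsUnique_isGenericRandomToRandom n k).exists

theorem genericRandomToRandom_commute (n i j : ℕ) :
    Commute (genericRandomToRandom n i) (genericRandomToRandom n j) := by
  have h := (shuffle_commute (n := n) (Polynomial.X : Polynomial ℤ)
    (fun s x hx => eq_zero_of_smul_eq_zero (pow_ne_zero s Polynomial.X_ne_zero) hx)
    le_rfl i j).eq
  rw [← qFactorial_smul_genericRandomToRandom, ← qFactorial_smul_genericRandomToRandom,
    smul_mul_smul_comm, smul_mul_smul_comm, mul_comm (qFactorial _ j)] at h
  exact smul_left_cancel_X (mul_ne_zero (qFactorial_X_ne_zero i) (qFactorial_X_ne_zero j)) h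

/-! ### Specialization of the parameter. -/

theorem specialize_T (n : ℕ) (q : A) (i : ℕ) :
    specialize n q (T n Polynomial.X i) = T n q i := by
  unfold T
  split_ifs
  · exact specialize_gen q _
  · exact map_zero _

theorem specialize_smul (n : ℕ) (q : A) (p : Polynomial ℤ)
    (x : HeckeAlgebra n (Polynomial.X : Polynomial ℤ)) :
    specialize n q (p • x) = Polynomial.aeval q p • specialize n q x := by
  rw [Algebra.smul_def, map_mul, specialize_algebraMap, ← Algebra.smul_def]

theorem specialize_B (n : ℕ) (q : A) (m : ℕ) :
    specialize n q (B n Polynomial.X m) = B n q m := by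
  induction m with
  | zero => rw [B_zero, B_zero, map_zero]
  | succ m ih => rw [B_succ, B_succ, map_add, map_mul, map_one, ih, specialize_T]

theorem specialize_star_B (n : ℕ) (q : A) (m : ℕ) :
    specialize n q (star (B n Polynomial.X m)) = star (B n q m) := by
  induction m with
  | zero => rw [B_zero, B_zero, star_zero, star_zero, map_zero]
  | succ m ih => rw [star_B_succ, star_B_succ, map_add, map_mul, map_one, ih, specialize_T]

theorem specialize_shuffle (n : ℕ) (q : A) (m k : ℕ) :
    specialize n q (shuffle n Polynomial.X m k) = shuffle n q m k := by
  induction m generalizing k with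
  | zero => cases k <;> simp [shuffle]
  | succ m ih => cases k <;> simp [shuffle, ih, specialize_B, specialize_star_B]

theorem aeval_qFactorial (q : A) (k : ℕ) :
    Polynomial.aeval q (qFactorial (Polynomial.X : Polynomial ℤ) k) = qFactorial q k := by
  simp [qFactorial, qInt, map_prod, map_sum]

theorem qFactorial_smul_randomToRandom (n : ℕ) (q : A) (k : ℕ) :
    qFactorial q k • randomToRandom n q k = randomToBottom n q k * bottomToRandom n q k := by
  rw [randomToBottom_mul_bottomToRandom, ← specialize_shuffle,
    ← qFactorial_smul_genericRandomToRandom, specialize_smul, aeval_qFactorial, randomToRandom]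

end

end HeckeAlgebra

theorem mainTheorem1 {𝕜 : Type*} [Field 𝕜] (q : 𝕜) (n : ℕ) :
    (∀ k : ℕ, ∃! r : HeckeAlgebra n (Polynomial.X : Polynomial ℤ),
      HeckeAlgebra.IsGenericRandomToRandom n k r) ∧
    (∀ k : ℕ, HeckeAlgebra.qFactorial q k ≠ 0 →
      HeckeAlgebra.randomToRandom n q k =
        (HeckeAlgebra.qFactorial q k)⁻¹ •
          (HeckeAlgebra.randomToBottom n q k * HeckeAlgebra.bottomToRandom n q k)) ∧
    (∀ i j : ℕ, Commute (HeckeAlgebra.randomToRandom n q i)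
      (HeckeAlgebra.randomToRandom n q j)) := by
  refine ⟨HeckeAlgebra.existsUnique_isGenericRandomToRandom n, fun k hk => ?_, fun i j => ?_⟩
  · rw [← HeckeAlgebra.qFactorial_smul_randomToRandom, inv_smul_smul₀ hk]
  · exact (HeckeAlgebra.genericRandomToRandom_commute n i j).map (HeckeAlgebra.specialize n q)
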